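/- Let $X$ be a locally compact Hausdorff space with countable base, and let $\mathfrak X=(\Omega,X_t,\theta_t,\mathbb P^x)$ be a diffusion on $X$, i.e. a Hunt process on $X$ (with cemetery the point at infinity of the one-point compactification of $X$, isolated if $X$ is compact; the lifetime may be finite) whose trajectories are continuous up to the lifetime. For open $U\subset X$ let $\tau_U:=\inf\{t\ge 0: X_t\in X\setminus U\}$ be the exit time, $$H_U(x,B):=\mathbb P^x[X_{\tau_U}\in B,\ \tau_U<\infty]\quad(x\in X,\ B\subset X \text{ Borel}),\qquad p_U(x):=\mathbb E^x\tau_U ,$$ and write $H_Uf(x):=\int f\,dH_U(x,\cdot)$. Consider the following conditions on an open set $V$. - $(D_1)$ $V$ is relatively compact, and $p_V$ is real-valued and continuous on $V$ and tends to zero at $\partial V$. - $(D_2)$ For all $z\in\partial V$ and all neighborhoods $W$ of $z$, $\lim_{x\to z}H_V(x,X\setminus W)=0$; and $(H_Vf)|_V$ is continuous for every bounded Borel function $f$ on $X$. $\mathfrak X$ is called a Bauer diffusion if the topology of $X$ has a base all of whose members satisfy $(D_1)$ and $(D_2)$. Let $\mathcal V$ be a base for the topology of $X$ consisting of relatively compact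 open sets. A *boundary kernel* for an open set $V$ is a kernel $T$ on $X$ with $T(x,X\setminus\partial V)=0$ for $x\in V$ and $T(x,\cdot)=\varepsilon_x$ for $x\notin V$. Suppose that a boundary kernel $H_V$ for $V$ is given for each $V\in\mathcal V$. A *local choice* $\mathcal W$ from $\mathcal V$ in an open set $U$ assigns to each $x\in U$ a fundamental system $\mathcal W(x)$ of neighborhoods of $x$ consisting of sets $W\in\mathcal V$ with $\overline W\subset U$. A lower semicontinuous function $u:U\to{]-\infty,\infty]}$ is *$\mathcal W$-hyperharmonic on $U$* if $H_Wu(x)\le u(x)$ for all $x\in U$ and $W\in\mathcal W(x)$; it is *hyperharmonic on $U$* if this holds for all $x\in U$ and all $W\in\mathcal V$ with $x\in W$ and $\overline W\subset U$. The family $(H_V)_{V\in\mathcal V}$ is a *normal Bauer family of harmonic boundary kernels* if, for every $V\in\mathcal V$: - $(H_1)$ $H_WH_V=H_V$ for every $W\in\mathcal V$ with $W\subset V$; - $(H_2)$ $H_Vf$ is a continuous real function on $X$ for every continuous $f:X\to\mathbb R$, and $H_V1=1$; - $(H_3)$ there is a local choice $\mathcal W$ from $\mathcal V$ in $V$ such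 that the positive $\mathcal W$-hyperharmonic functions on $V$ separate the points of $V$; - $(H_4)$ $H_Vf$ is continuous on $V$ for every bounded Borel function $f$ on $X$. **Proposition.** Let $\mathfrak X$ be a Bauer diffusion on $X$ and let $\mathcal V$ be a base for the topology of $X$, consisting of relatively compact open sets, such that every $V\in\mathcal V$ satisfies $(D_1)$ and $(D_2)$. Then, for all $U,V\in\mathcal V$ with $\overline U\subset V$, the functions $p_V$ and $H_Up_V$ are hyperharmonic on $V$ (with respect to the exit kernels $H_W$, $W\in\mathcal V$), and $$p_V-H_Up_V=p_U>0\quad\text{on } U$$ (all terms being finite on $U$). In particular, the exit kernels $(H_V)_{V\in\mathcal V}$ form a normal Bauer family of harmonic boundary kernels on $X$. -/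

import Mathlib

open Set Filter MeasureTheory
open scoped NNReal ENNReal Topology

/-- The state space with cemetery, the one-point compactification of `X` (in which the added point
is isolated if `X` is compact), carries its Borel σ-algebra. -/
instance onePointMeasurableSpace (X : Type*) [TopologicalSpace X] :
    MeasurableSpace (OnePoint X) := borel (OnePoint X)

instance onePointBorelSpace (X : Type*) [TopologicalSpace X] : BorelSpace (OnePoint X) := ⟨rfl⟩

/-- The state `Z_T` at a random time `T : Ω → [0, ∞]`, with the convention that `Z_∞` is the
cemetery `OnePoint.infty`. -/
noncomputable def stateAt {X Ω : Type*} (Z : ℝ≥0 → Ω → OnePoint X) (T : Ω → ℝ≥0∞) (ω : Ω) :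
    OnePoint X :=
  open scoped Classical in
  if T ω = ⊤ then OnePoint.infty else Z (T ω).toNNReal ω

/-- A Hunt process with state space `X` and cemetery `OnePoint.infty` (so the lifetime may be
finite), given on the measurable space `Ω`. -/
structure HuntProcess (X : Type*) [TopologicalSpace X] (Ω : Type*) [mΩ : MeasurableSpace Ω] where
  /-- the state at time `t` -/
  Z : ℝ≥0 → Ω → OnePoint X
  /-- the shift operators -/
  θ : ℝ≥0 → Ω → Ω
  /-- the law of the process started in `x` -/
  P : OnePoint X → Measure Ω
  /-- the admissible filtration -/
  𝓜 : Filtration ℝ≥0 mΩ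
  isProbabilityMeasure : ∀ x, IsProbabilityMeasure (P x)
  /-- the filtration is right-continuous, and the process is adapted to it -/
  rightContinuous : 𝓜.IsRightContinuous
  adapted : ∀ t, Measurable[𝓜 t] (Z t)
  /-- probabilities of events generated by the process are Borel functions of the initial state -/
  measurable_P : ∀ A : Set Ω,
    MeasurableSet[⨆ t, MeasurableSpace.comap (Z t) (onePointMeasurableSpace X)] A →
      Measurable fun x => P x A
  /-- the process started in `x` starts in `x` -/
  start : ∀ x, ∀ᵐ ω ∂(P x), Z 0 ω = x
  /-- the cemetery is a trap -/
  trap : ∀ ω s t, s ≤ t → Z s ω = OnePoint.infty → Z t ω = OnePoint.infty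
  shift : ∀ s t ω, Z s (θ t ω) = Z (s + t) ω
  /-- the paths are right-continuous and have left limits, in `OnePoint X` -/
  path_right : ∀ ω t, ContinuousWithinAt (fun s => Z s ω) (Ici t) t
  path_left : ∀ ω t, 0 < t → ∃ l : OnePoint X, Tendsto (fun s => Z s ω) (𝓝[<] t) (𝓝 l)
  /-- the strong Markov property: given the past of a stopping time `T`, on `{T < ∞}` the shifted
  process has the law `P` with starting point `Z_T` -/
  strongMarkov : ∀ (T : Ω → ℝ≥0∞) (hT : IsStoppingTime 𝓜 T) (x : OnePoint X) (Λ A : Set Ω),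
    MeasurableSet[hT.measurableSpace] Λ →
    MeasurableSet[⨆ t, MeasurableSpace.comap (Z t) (onePointMeasurableSpace X)] A →
      P x {ω | ω ∈ Λ ∧ T ω ≠ ⊤ ∧ θ (T ω).toNNReal ω ∈ A} =
        ∫⁻ ω in {ω | ω ∈ Λ ∧ T ω ≠ ⊤}, P (stateAt Z T ω) A ∂(P x)
  /-- quasi-left-continuity -/
  quasiLeftContinuous : ∀ (S : ℕ → Ω → ℝ≥0∞) (T : Ω → ℝ≥0∞),
    (∀ n, IsStoppingTime 𝓜 (S n)) → (∀ ω, Monotone fun n => S n ω) → (∀ ω, T ω = ⨆ n, S n ω) →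
      ∀ x, ∀ᵐ ω ∂(P x), T ω ≠ ⊤ →
        Tendsto (fun n => stateAt Z (S n) ω) atTop (𝓝 (stateAt Z T ω))

namespace HuntProcess

variable {X : Type*} [TopologicalSpace X] {Ω : Type*} [MeasurableSpace Ω]

/-- A diffusion is a Hunt process all of whose trajectories are continuous during the lifetime. -/
def IsDiffusion (𝔛 : HuntProcess X Ω) : Prop :=
  ∀ ω, ContinuousOn (fun t => 𝔛.Z t ω) {t | 𝔛.Z t ω ≠ OnePoint.infty}

/-- The exit time `τ_U = inf {t ≥ 0 : Z_t ∈ X \ U}` (with `inf ∅ = ∞`). -/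
noncomputable def exitTime (𝔛 : HuntProcess X Ω) (U : Set X) (ω : Ω) : ℝ≥0∞ :=
  sInf {r | ∃ t : ℝ≥0, r = t ∧ ∃ y ∈ Uᶜ, 𝔛.Z t ω = (y : OnePoint X)}

/-- The exit kernel: `H_U (x, B) = P^x [Z_{τ_U} ∈ B, τ_U < ∞]`. The comap restricts the law of
`Z_{τ_U}` (which is the cemetery if `τ_U = ∞`) to `X`. -/
noncomputable def exitKernel [MeasurableSpace X] (𝔛 : HuntProcess X Ω) (U : Set X) (x : X) :
    Measure X :=
  ((𝔛.P x).map (stateAt 𝔛.Z (𝔛.exitTime U))).comap ((↑) : X → OnePoint X)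

/-- The expected exit time `p_U (x) = E^x τ_U`. -/
noncomputable def expectedExitTime (𝔛 : HuntProcess X Ω) (U : Set X) (x : X) : ℝ≥0∞ :=
  ∫⁻ ω, 𝔛.exitTime U ω ∂(𝔛.P x)

/-- `V` is relatively compact, and `p_V` is a continuous real function on `V` which tends to zero
at the boundary of `V`. -/
def D1 (𝔛 : HuntProcess X Ω) (V : Set X) : Prop :=
  IsCompact (closure V) ∧ (∀ x ∈ V, 𝔛.expectedExitTime V x ≠ ⊤) ∧
    ContinuousOn (𝔛.expectedExitTime V) V ∧
    ∀ z ∈ frontier V, Tendsto (𝔛.expectedExitTime V) (𝓝[V] z) (𝓝 0)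

/-- `lim_{x → z} H_V (x, X \ W) = 0` for the (open) neighborhoods `W` of the boundary points `z`,
and `H_V f` is continuous on `V` for every bounded Borel function `f`. -/
def D2 [MeasurableSpace X] (𝔛 : HuntProcess X Ω) (V : Set X) : Prop :=
  (∀ z ∈ frontier V, ∀ W : Set X, IsOpen W → z ∈ W →
    Tendsto (fun x => 𝔛.exitKernel V x Wᶜ) (𝓝 z) (𝓝 0)) ∧
  ∀ f : X → ℝ, Measurable f → (∃ C, ∀ y, |f y| ≤ C) →
    ContinuousOn (fun x => ∫ y, f y ∂(𝔛.exitKernel V x)) V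

/-- A Bauer diffusion. -/
def IsBauerDiffusion [MeasurableSpace X] (𝔛 : HuntProcess X Ω) : Prop :=
  𝔛.IsDiffusion ∧ ∃ 𝓥 : Set (Set X), TopologicalSpace.IsTopologicalBasis 𝓥 ∧
    ∀ V ∈ 𝓥, 𝔛.D1 V ∧ 𝔛.D2 V

end HuntProcess

section Analytic

variable {X : Type*} [TopologicalSpace X] [MeasurableSpace X]

/-- `T` is a kernel on `X` with `T(x, X \ ∂U) = 0` for `x ∈ U` and `T(x, ·) = ε_x` for `x ∉ U`.
Measurability of `T` into the measures on `X` says that all `x ↦ T(x, B)`, `B` Borel, are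
measurable. -/
def IsBoundaryKernel (T : X → Measure X) (U : Set X) : Prop :=
  Measurable T ∧ (∀ x ∈ U, T x (frontier U)ᶜ = 0) ∧ ∀ x ∉ U, T x = Measure.dirac x

/-- The integral of an extended real function whose negative part has a finite integral: the
integral of the positive part minus the integral of the negative part. -/
noncomputable def erealIntegral (μ : Measure X) (u : X → EReal) : EReal :=
  ((∫⁻ y, (u y).toENNReal ∂μ : ℝ≥0∞) : EReal) - ((∫⁻ y, (-u y).toENNReal ∂μ : ℝ≥0∞) : EReal)

/-- `𝓦` is a local choice from `𝓥` in `U`: each `𝓦 x`, `x ∈ U`, is a fundamental system of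
neighborhoods of `x` consisting of sets from `𝓥` with closure contained in `U`. -/
def IsLocalChoice (𝓥 : Set (Set X)) (U : Set X) (𝓦 : X → Set (Set X)) : Prop :=
  ∀ x ∈ U, (∀ W ∈ 𝓦 x, W ∈ 𝓥 ∧ closure W ⊆ U) ∧ (𝓝 x).HasBasis (fun W => W ∈ 𝓦 x) id

/-- `u` is `𝓦`-hyperharmonic on `U` with respect to the kernels `H W`. Only the values of `u` on
`U` matter, since `H W x`, `x ∈ W`, will be carried by `∂W ⊆ U`; the negative part of `u` is bounded
on this compact set. -/
def IsLocallyHyperharmonic (H : Set X → X → Measure X) (𝓦 : X → Set (Set X)) (U : Set X)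
    (u : X → EReal) : Prop :=
  LowerSemicontinuousOn u U ∧ (∀ x ∈ U, u x ≠ ⊥) ∧
    ∀ x ∈ U, ∀ W ∈ 𝓦 x, erealIntegral (H W x) u ≤ u x

/-- `u` is hyperharmonic on `U`: the local choice consists of all `W ∈ 𝓥` with closure contained
in `U` and `x ∈ W`. -/
def IsHyperharmonic (𝓥 : Set (Set X)) (H : Set X → X → Measure X) (U : Set X)
    (u : X → EReal) : Prop :=
  IsLocallyHyperharmonic H (fun x => {W | W ∈ 𝓥 ∧ closure W ⊆ U ∧ x ∈ W}) U u

/-- `(H V)`, `V ∈ 𝓥`, is a normal Bauer family of harmonic boundary kernels on `X`. -/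
structure IsNormalBauerFamily (𝓥 : Set (Set X)) (H : Set X → X → Measure X) : Prop where
  isTopologicalBasis : TopologicalSpace.IsTopologicalBasis 𝓥
  isCompact_closure : ∀ V ∈ 𝓥, IsCompact (closure V)
  isBoundaryKernel : ∀ V ∈ 𝓥, IsBoundaryKernel (H V) V
  /-- `H_W H_V = H_V` if `W ⊆ V` -/
  comp_eq : ∀ V ∈ 𝓥, ∀ W ∈ 𝓥, W ⊆ V → ∀ x, ∀ B, MeasurableSet B →
    ∫⁻ y, H V y B ∂(H W x) = H V x B
  /-- `H_V` maps continuous real functions to continuous real functions -/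
  continuous : ∀ V ∈ 𝓥, ∀ f : X → ℝ, Continuous f →
    (∀ x, Integrable f (H V x)) ∧ Continuous fun x => ∫ y, f y ∂(H V x)
  /-- `H_V 1 = 1` -/
  normal : ∀ V ∈ 𝓥, ∀ x, H V x univ = 1
  /-- for some local choice `𝓦` on `V`, the positive `𝓦`-hyperharmonic functions on `V` separate
  the points of `V` -/
  separates : ∀ V ∈ 𝓥, ∃ 𝓦 : X → Set (Set X), IsLocalChoice 𝓥 V 𝓦 ∧
    ∀ x ∈ V, ∀ y ∈ V, x ≠ y → ∃ u : X → EReal, IsLocallyHyperharmonic H 𝓦 V u ∧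
      (∀ z ∈ V, 0 ≤ u z) ∧ u x ≠ u y
  /-- `H_V f` is continuous on `V` for every bounded Borel function `f` -/
  continuousOn : ∀ V ∈ 𝓥, ∀ f : X → ℝ, Measurable f → (∃ C, ∀ y, |f y| ≤ C) →
    ContinuousOn (fun x => ∫ y, f y ∂(H V x)) V

end Analytic

/-!
If `W ⊆ V`, a path leaves `V` only after leaving `W`, so the strong Markov property at `τ_W` gives
`p_V = p_W + H_W p_V` and `H_W H_V = H_V`; for arbitrary open `U` and `W` it still gives
`p_U ≤ p_W + H_W p_U`. The former says that `p_V` is hyperharmonic and `p_V - H_U p_V = p_U`, and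
together with the latter it yields `H_W H_U p_V ≤ H_U p_V`. If `p_V` does not separate `x` and `y`,
then `H_U p_V` does whenever `x ∈ U` and `y ∉ U`, because `p_U` is positive at `x` and zero at `y`.
Finally `H_V f` is continuous across `∂V` since, by `(D_2)`, the exit distributions from `x ∈ V`
converge weakly to the Dirac measure at `z ∈ ∂V` as `x → z`.
-/

theorem continuous_of_continuousOn_of_tendsto_frontier {X Y : Type*} [TopologicalSpace X]
    [TopologicalSpace Y] {V : Set X} {F : X → Y} (hV : IsOpen V) (hin : ContinuousOn F V)
    (hout : ContinuousOn F Vᶜ) (hfr : ∀ z ∈ frontier V, Tendsto F (𝓝[V] z) (𝓝 (F z))) :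
    Continuous F := by
  rw [continuous_iff_continuousAt]
  intro z
  by_cases hz : z ∈ V
  · exact hin.continuousAt (hV.mem_nhds hz)
  rw [ContinuousAt, ← nhdsWithin_univ, ← union_compl_self V, nhdsWithin_union]
  refine Tendsto.sup ?_ (hout z hz)
  by_cases hz' : z ∈ closure V
  · exact hfr z ⟨hz', by rwa [hV.interior_eq]⟩
  · rw [notMem_closure_iff_nhdsWithin_eq_bot.1 hz']
    exact tendsto_bot

theorem exists_boundedContinuousFunction_eqOn {X : Type*} [TopologicalSpace X] {K : Set X}
    (hK : IsCompact K) {f : X → ℝ} (hf : Continuous f) :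
    ∃ g : BoundedContinuousFunction X ℝ, EqOn g f K := by
  obtain ⟨C, hC⟩ := hK.exists_bound_of_continuousOn hf.continuousOn
  refine ⟨.ofNormedAddCommGroup (fun y => max (-C) (min C (f y))) (by fun_prop) |C| fun y => ?_,
    fun y hy => ?_⟩
  · rw [Real.norm_eq_abs, abs_le]
    exact ⟨le_max_of_le_left (neg_le_neg (le_abs_self C)),
      max_le (neg_le_abs C) ((min_le_left _ _).trans (le_abs_self C))⟩
  · have hy' := abs_le.1 (hC y hy)
    simp [hy'.1, hy'.2]

theorem tendsto_diracProba_of_tendsto_measure_compl {X ι : Type*} [TopologicalSpace X]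
    [MeasurableSpace X] [OpensMeasurableSpace X] {l : Filter ι} [l.IsCountablyGenerated]
    {μ : ι → ProbabilityMeasure X} {z : X}
    (h : ∀ W : Set X, IsOpen W → z ∈ W → Tendsto (fun i => (μ i : Measure X) Wᶜ) l (𝓝 0)) :
    Tendsto μ l (𝓝 (diracProba z)) := by
  refine tendsto_of_forall_isOpen_le_liminf' fun W hW => ?_
  by_cases hz : z ∈ W
  · have hlim : Tendsto (fun i => (μ i : Measure X) W) l (𝓝 1) := by
      have hsub := ENNReal.Tendsto.sub tendsto_const_nhds (h W hW hz) (.inl ENNReal.one_ne_top)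
      simpa only [prob_compl_eq_one_sub hW.measurableSet.compl, compl_compl, tsub_zero] using
        hsub.congr fun i => (prob_compl_eq_one_sub hW.measurableSet.compl).symm
    rcases l.eq_or_neBot with rfl | _
    · simp
    · rw [hlim.liminf_eq]
      exact prob_le_one
  · rw [diracProba_toMeasure_apply' z hW.measurableSet, indicator_of_notMem hz]
    exact zero_le

theorem exists_mem_isClosed_iff_forall_exists_infDist_lt {α Y : Type*} [TopologicalSpace α]
    [PseudoMetricSpace Y] {K D : Set α} {F : Set Y} {f : α → Y} (hK : IsCompact K) (hDK : D ⊆ K)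
    (hKD : K ⊆ closure D) (hf : ContinuousOn f K) (hF : IsClosed F) (hFne : F.Nonempty) :
    (∃ s ∈ K, f s ∈ F) ↔ ∀ n : ℕ, ∃ d ∈ D, Metric.infDist (f d) F < 1 / ((n : ℝ) + 1) := by
  have hg : ContinuousOn (fun s => Metric.infDist (f s) F) K :=
    (Metric.continuous_infDist_pt F).comp_continuousOn hf
  constructor
  · rintro ⟨s, hsK, hsF⟩ n
    have : (𝓝[D] s).NeBot := mem_closure_iff_nhdsWithin_neBot.1 (hKD hsK)
    have hs : Metric.infDist (f s) F < 1 / ((n : ℝ) + 1) := by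
      rw [Metric.infDist_zero_of_mem hsF]
      positivity
    exact (eventually_mem_nhdsWithin.and
      (((hg s hsK).mono hDK).tendsto.eventually_lt_const hs)).exists
  · intro h
    obtain ⟨d₀, hd₀, -⟩ := h 0
    obtain ⟨s, hsK, hmin⟩ := hK.exists_isMinOn ⟨d₀, hDK hd₀⟩ hg
    refine ⟨s, hsK, (hF.mem_iff_infDist_zero hFne).2 ?_⟩
    refine le_antisymm (le_of_forall_pos_le_add fun ε hε => ?_) Metric.infDist_nonneg
    obtain ⟨n, hn⟩ := exists_nat_one_div_lt hε
    obtain ⟨d, hdD, hd⟩ := h n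
    rw [zero_add]
    exact (hmin (hDK hdD)).trans (hd.trans hn).le

theorem tendsto_floor_mul_add_one_div_nhdsGE (t : ℝ≥0) :
    Tendsto (fun n : ℕ => ((⌊t * (n + 1)⌋₊ : ℝ≥0) + 1) / (n + 1)) atTop (𝓝[≥] t) := by
  have hle : ∀ n : ℕ, t ≤ ((⌊t * (n + 1)⌋₊ : ℝ≥0) + 1) / (n + 1) := fun n => by
    rw [le_div_iff₀ (by positivity)]
    exact (Nat.lt_floor_add_one _).le
  have hge : ∀ n : ℕ, ((⌊t * (n + 1)⌋₊ : ℝ≥0) + 1) / (n + 1) ≤ t + 1 / ((n : ℝ≥0) + 1) :=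
    fun n => by
      rw [div_le_iff₀ (by positivity), add_mul, one_div, inv_mul_cancel₀ (by positivity)]
      gcongr
      exact Nat.floor_le zero_le
  have hlim : Tendsto (fun n : ℕ => t + 1 / ((n : ℝ≥0) + 1)) atTop (𝓝 t) := by
    simpa using tendsto_const_nhds.add (tendsto_one_div_add_atTop_nhds_zero_nat (𝕜 := ℝ≥0))
  exact tendsto_nhdsWithin_iff.2
    ⟨tendsto_of_tendsto_of_tendsto_of_le_of_le tendsto_const_nhds hlim hle hge, .of_forall hle⟩

theorem measurable_eval_randomTime {Ω Y : Type*} [MeasurableSpace Ω] [TopologicalSpace Y]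
    [TopologicalSpace.PseudoMetrizableSpace Y] [MeasurableSpace Y] [BorelSpace Y]
    {Z : ℝ≥0 → Ω → Y} (hZ : ∀ t, Measurable (Z t))
    (hr : ∀ ω t, ContinuousWithinAt (fun s => Z s ω) (Ici t) t)
    {T : Ω → ℝ≥0} (hT : Measurable T) : Measurable fun ω => Z (T ω) ω := by
  have hdiscrete (g : ℕ → ℝ≥0) {N : Ω → ℕ} (hN : Measurable N) :
      Measurable fun ω => Z (g (N ω)) ω :=
    (measurable_from_prod_countable_right (f := fun p : ℕ × Ω => Z (g p.1) p.2)
      fun k => hZ (g k)).comp (hN.prodMk measurable_id)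
  have happrox (n : ℕ) : Measurable fun ω => Z (((⌊T ω * (n + 1)⌋₊ : ℝ≥0) + 1) / (n + 1)) ω :=
    hdiscrete (fun k => ((k : ℝ≥0) + 1) / (n + 1)) (hT.mul_const _).nat_floor
  exact measurable_of_tendsto_metrizable happrox <| tendsto_pi_nhds.2 fun ω =>
    (hr ω (T ω)).tendsto.comp (tendsto_floor_mul_add_one_div_nhdsGE (T ω))

theorem lintegral_comp_eq_lintegral_lintegral {Ω E : Type*} [MeasurableSpace Ω]
    [MeasurableSpace E] {μ : Measure Ω} {Φ : Ω → E} {κ : Ω → Measure E} (hΦ : Measurable Φ)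
    (hκ : Measurable κ) (h : ∀ A, MeasurableSet A → μ (Φ ⁻¹' A) = ∫⁻ ω, κ ω A ∂μ)
    {f : E → ℝ≥0∞} (hf : Measurable f) :
    ∫⁻ ω, f (Φ ω) ∂μ = ∫⁻ ω, ∫⁻ y, f y ∂(κ ω) ∂μ := by
  have hmap : μ.map Φ = μ.bind κ := by
    ext A hA
    rw [Measure.map_apply hΦ hA, Measure.bind_apply hA hκ.aemeasurable, h A hA]
  rw [← lintegral_map hf hΦ, hmap, Measure.lintegral_bind hκ.aemeasurable hf.aemeasurable]

instance onePointSecondCountableTopology (X : Type*) [TopologicalSpace X] [T2Space X]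
    [LocallyCompactSpace X] [SecondCountableTopology X] : SecondCountableTopology (OnePoint X) := by
  let K := CompactExhaustion.choice X
  let b := TopologicalSpace.countableBasis X
  have hb : TopologicalSpace.IsTopologicalBasis
      (((fun s : Set X => ((↑) '' s : Set (OnePoint X))) '' b) ∪
        range fun n => ((↑) '' K n : Set (OnePoint X))ᶜ) := by
    refine TopologicalSpace.isTopologicalBasis_of_isOpen_of_nhds ?_ fun z u hz hu => ?_
    · rintro _ (⟨s, hs, rfl⟩ | ⟨n, rfl⟩)
      · exact OnePoint.isOpen_image_coe.2 (TopologicalSpace.isOpen_of_mem_countableBasis hs)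
      · exact OnePoint.isOpen_compl_image_coe.2 ⟨(K.isCompact n).isClosed, K.isCompact n⟩
    induction z using OnePoint.rec with
    | infty =>
      obtain ⟨n, hn⟩ := K.exists_superset_of_isCompact ((OnePoint.isOpen_iff_of_mem hz).1 hu).2
      refine ⟨_, .inr ⟨n, rfl⟩, OnePoint.infty_notMem_image_coe, ?_⟩
      exact (OnePoint.compl_image_coe _).subset.trans
        (union_subset (image_subset_iff.2 (compl_subset_comm.1 hn)) (singleton_subset_iff.2 hz))
    | coe x =>
      obtain ⟨s, hs, hxs, hsu⟩ :=
        (TopologicalSpace.isBasis_countableBasis X).exists_subset_of_mem_open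
          (show x ∈ (↑) ⁻¹' u from hz) (hu.preimage OnePoint.continuous_coe)
      exact ⟨_, .inl ⟨s, hs, rfl⟩, mem_image_of_mem _ hxs, image_subset_iff.2 hsu⟩
  exact hb.secondCountableTopology
    (((TopologicalSpace.countable_countableBasis X).image _).union (countable_range _))

theorem mem_image_coe_compl_iff {X : Type*} {U : Set X} {z : OnePoint X} :
    z ∈ ((↑) '' Uᶜ : Set (OnePoint X)) ↔
      z ∉ ((↑) '' U : Set (OnePoint X)) ∧ z ≠ OnePoint.infty := by
  induction z using OnePoint.rec <;> simp

theorem measurableEmbedding_onePoint_coe {X : Type*} [TopologicalSpace X] [MeasurableSpace X]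
    [BorelSpace X] : MeasurableEmbedding ((↑) : X → OnePoint X) :=
  OnePoint.isOpenEmbedding_coe.measurableEmbedding

namespace HuntProcess

section Paths

variable {X : Type*} [TopologicalSpace X] {Ω : Type*} [MeasurableSpace Ω] (𝔛 : HuntProcess X Ω)

theorem Z_ne_infty_of_le {s t : ℝ≥0} {ω : Ω} (hst : s ≤ t) (ht : 𝔛.Z t ω ≠ OnePoint.infty) :
    𝔛.Z s ω ≠ OnePoint.infty :=
  fun hs => ht (𝔛.trap ω s t hst hs)

theorem exitTime_eq_sInf_image (U : Set X) (ω : Ω) :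
    𝔛.exitTime U ω = sInf ((↑) '' {t : ℝ≥0 | 𝔛.Z t ω ∈ ((↑) '' Uᶜ : Set (OnePoint X))}) := by
  simp only [exitTime, image, mem_ofPred_eq, eq_comm, and_comm]

theorem exitTime_le_of_mem {U : Set X} {ω : Ω} {t : ℝ≥0}
    (h : 𝔛.Z t ω ∈ ((↑) '' Uᶜ : Set (OnePoint X))) : 𝔛.exitTime U ω ≤ t := by
  rw [exitTime_eq_sInf_image]
  exact sInf_le (mem_image_of_mem _ h)

theorem exitTime_anti {U V : Set X} (h : U ⊆ V) (ω : Ω) : 𝔛.exitTime U ω ≤ 𝔛.exitTime V ω := by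
  simp only [exitTime_eq_sInf_image]
  exact sInf_le_sInf (image_mono fun t ht => image_mono (compl_subset_compl.2 h) ht)

theorem mem_image_coe_of_lt_exitTime {U : Set X} {ω : Ω} {t : ℝ≥0} (ht : t < 𝔛.exitTime U ω)
    (halive : 𝔛.Z t ω ≠ OnePoint.infty) : 𝔛.Z t ω ∈ ((↑) '' U : Set (OnePoint X)) := by
  by_contra h
  exact ht.not_ge (𝔛.exitTime_le_of_mem (mem_image_coe_compl_iff.2 ⟨h, halive⟩))

theorem Z_exitTime_mem {U : Set X} (hU : IsOpen U) {ω : Ω} (h : 𝔛.exitTime U ω ≠ ⊤) :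
    𝔛.Z (𝔛.exitTime U ω).toNNReal ω ∈ ((↑) '' Uᶜ : Set (OnePoint X)) := by
  set S : Set ℝ≥0 := {t | 𝔛.Z t ω ∈ ((↑) '' Uᶜ : Set (OnePoint X))}
  have hτ : 𝔛.exitTime U ω = sInf ((↑) '' S) := 𝔛.exitTime_eq_sInf_image U ω
  have hne : S.Nonempty := by
    by_contra hne
    exact h (by rw [hτ, not_nonempty_iff_eq_empty.1 hne, image_empty, sInf_empty])
  have hτS : (𝔛.exitTime U ω).toNNReal = sInf S := by
    rw [hτ, sInf_image, ← ENNReal.coe_sInf hne, ENNReal.toNNReal_coe]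
  have hle : S ⊆ Ici (sInf S) := fun t ht => csInf_le (OrderBot.bddBelow S) ht
  have : (𝓝[S] (sInf S)).NeBot :=
    mem_closure_iff_nhdsWithin_neBot.1 (csInf_mem_closure hne (OrderBot.bddBelow S))
  rw [hτS]
  refine mem_image_coe_compl_iff.2 ⟨?_, ?_⟩
  · have hclosed := (OnePoint.isOpen_image_coe.2 hU).isClosed_compl
    exact hclosed.mem_of_tendsto ((𝔛.path_right ω (sInf S)).mono hle)
      (eventually_mem_nhdsWithin.mono fun t ht => (mem_image_coe_compl_iff.1 ht).1)
  · obtain ⟨t, ht⟩ := hne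
    exact 𝔛.Z_ne_infty_of_le (hle ht) (mem_image_coe_compl_iff.1 ht).2

theorem exitTime_le_iff {U : Set X} (hU : IsOpen U) {ω : Ω} {t : ℝ≥0} :
    𝔛.exitTime U ω ≤ t ↔ ∃ s ≤ t, 𝔛.Z s ω ∈ ((↑) '' Uᶜ : Set (OnePoint X)) := by
  constructor
  · intro h
    exact ⟨_, (ENNReal.toNNReal_mono ENNReal.coe_ne_top h).trans_eq (ENNReal.toNNReal_coe t),
      𝔛.Z_exitTime_mem hU (ne_top_of_le_ne_top ENNReal.coe_ne_top h)⟩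
  · rintro ⟨s, hs, hsU⟩
    exact (𝔛.exitTime_le_of_mem hsU).trans (ENNReal.coe_le_coe.2 hs)

theorem exitTime_le_add_shift {U : Set X} (hU : IsOpen U) (r : ℝ≥0) (ω : Ω) :
    𝔛.exitTime U ω ≤ r + 𝔛.exitTime U (𝔛.θ r ω) := by
  by_cases h : 𝔛.exitTime U (𝔛.θ r ω) = ⊤
  · simp [h]
  · have hmem := 𝔛.Z_exitTime_mem hU h
    rw [𝔛.shift] at hmem
    simpa [ENNReal.coe_toNNReal h, add_comm] using 𝔛.exitTime_le_of_mem hmem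

theorem exitTime_eq_add_shift {U : Set X} (hU : IsOpen U) {r : ℝ≥0} {ω : Ω}
    (hr : r ≤ 𝔛.exitTime U ω) : 𝔛.exitTime U ω = r + 𝔛.exitTime U (𝔛.θ r ω) := by
  refine le_antisymm (𝔛.exitTime_le_add_shift hU r ω) ?_
  by_cases h : 𝔛.exitTime U ω = ⊤
  · simp [h]
  · lift 𝔛.exitTime U ω to ℝ≥0 using h with τ hτ
    have hmem := 𝔛.Z_exitTime_mem hU (hτ ▸ ENNReal.coe_ne_top)
    rw [← hτ, ENNReal.toNNReal_coe] at hmem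
    have hrτ : r ≤ τ := ENNReal.coe_le_coe.1 hr
    have hshift : 𝔛.exitTime U (𝔛.θ r ω) ≤ (τ - r : ℝ≥0) :=
      𝔛.exitTime_le_of_mem (by rwa [𝔛.shift, tsub_add_cancel_of_le hrτ])
    calc (r : ℝ≥0∞) + 𝔛.exitTime U (𝔛.θ r ω) ≤ r + (τ - r : ℝ≥0) := by gcongr
      _ = τ := by rw [← ENNReal.coe_add, add_tsub_cancel_of_le hrτ]

/-- The state `Z_{τ_U}` at the exit time from `U`, which is the cemetery if `τ_U = ∞`. -/
noncomputable def exitState (U : Set X) (ω : Ω) : OnePoint X :=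
  stateAt 𝔛.Z (𝔛.exitTime U) ω

theorem exitState_of_ne_top {U : Set X} {ω : Ω} (h : 𝔛.exitTime U ω ≠ ⊤) :
    𝔛.exitState U ω = 𝔛.Z (𝔛.exitTime U ω).toNNReal ω :=
  if_neg h

theorem exitState_of_eq_top {U : Set X} {ω : Ω} (h : 𝔛.exitTime U ω = ⊤) :
    𝔛.exitState U ω = OnePoint.infty :=
  if_pos h

theorem exitState_mem_range_iff {U : Set X} (hU : IsOpen U) {ω : Ω} :
    𝔛.exitState U ω ∈ range ((↑) : X → OnePoint X) ↔ 𝔛.exitTime U ω ≠ ⊤ := by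
  refine ⟨fun h hτ => ?_, fun h => ?_⟩
  · rw [𝔛.exitState_of_eq_top hτ] at h
    exact OnePoint.infty_notMem_range_coe h
  · rw [𝔛.exitState_of_ne_top h]
    exact image_subset_range _ _ (𝔛.Z_exitTime_mem hU h)

theorem exitState_shift {U : Set X} (hU : IsOpen U) {r : ℝ≥0} {ω : Ω}
    (hr : r ≤ 𝔛.exitTime U ω) : 𝔛.exitState U (𝔛.θ r ω) = 𝔛.exitState U ω := by
  have hadd := 𝔛.exitTime_eq_add_shift hU hr
  by_cases h : 𝔛.exitTime U (𝔛.θ r ω) = ⊤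
  · rw [𝔛.exitState_of_eq_top h, 𝔛.exitState_of_eq_top (by rw [hadd, h, add_top])]
  · have h' : 𝔛.exitTime U ω ≠ ⊤ := hadd ▸ ENNReal.add_ne_top.2 ⟨ENNReal.coe_ne_top, h⟩
    rw [𝔛.exitState_of_ne_top h, 𝔛.exitState_of_ne_top h', 𝔛.shift, hadd,
      ENNReal.toNNReal_add ENNReal.coe_ne_top h, ENNReal.toNNReal_coe, add_comm]

theorem IsDiffusion.exitState_mem_closure {𝔛 : HuntProcess X Ω} (hd : 𝔛.IsDiffusion) {U : Set X}
    (hU : IsOpen U) {ω : Ω} (h : 𝔛.exitTime U ω ≠ ⊤) (hpos : 0 < 𝔛.exitTime U ω) :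
    𝔛.exitState U ω ∈ closure ((↑) '' U : Set (OnePoint X)) := by
  have hmem := 𝔛.Z_exitTime_mem hU h
  rw [𝔛.exitState_of_ne_top h]
  lift 𝔛.exitTime U ω to ℝ≥0 using h with τ hτ
  rw [ENNReal.toNNReal_coe] at hmem ⊢
  have halive : ∀ s ≤ τ, 𝔛.Z s ω ≠ OnePoint.infty := fun s hs =>
    𝔛.Z_ne_infty_of_le hs (mem_image_coe_compl_iff.1 hmem).2
  have hcont : Tendsto (fun s => 𝔛.Z s ω) (𝓝[<] τ) (𝓝 (𝔛.Z τ ω)) :=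
    (hd ω τ (halive τ le_rfl)).mono fun s hs => halive s (le_of_lt hs)
  have : (𝓝[<] τ).NeBot := nhdsLT_neBot_of_exists_lt ⟨0, ENNReal.coe_pos.1 hpos⟩
  refine mem_closure_of_tendsto hcont (eventually_mem_nhdsWithin.mono fun s hs => ?_)
  exact 𝔛.mem_image_coe_of_lt_exitTime (hτ ▸ ENNReal.coe_lt_coe.2 hs) (halive s (le_of_lt hs))

end Paths

end HuntProcess

theorem measurable_stateAt {X Ω : Type*} [TopologicalSpace X] [T2Space X] [LocallyCompactSpace X]
    [SecondCountableTopology X] [MeasurableSpace Ω] {Z : ℝ≥0 → Ω → OnePoint X}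
    (hZ : ∀ t, Measurable (Z t)) (hr : ∀ ω t, ContinuousWithinAt (fun s => Z s ω) (Ici t) t)
    {T : Ω → ℝ≥0∞} (hT : Measurable T) : Measurable (stateAt Z T) :=
  Measurable.ite (p := fun ω => T ω = ⊤) (hT (measurableSet_singleton ⊤)) measurable_const
    (measurable_eval_randomTime hZ hr hT.ennreal_toNNReal)

namespace HuntProcess

section ExitTimeMeasurability

variable {X : Type*} [TopologicalSpace X] {Ω : Type*} {m mΩ : MeasurableSpace Ω}
  {𝔛 : HuntProcess X Ω}

theorem exitTime_le_iff_exists_dense {U : Set X} (hU : IsOpen U) {D : Set ℝ≥0} (hD : Dense D)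
    {ω : Ω} {t : ℝ≥0} :
    𝔛.exitTime U ω ≤ t ↔
      ∃ q ∈ insert t (D ∩ Iic t), 𝔛.Z q ω ≠ OnePoint.infty ∧ 𝔛.exitTime U ω ≤ q := by
  constructor
  · intro h
    obtain ⟨s, hst, hs⟩ := (𝔛.exitTime_le_iff hU).1 h
    have halive : 𝔛.Z s ω ≠ OnePoint.infty := (mem_image_coe_compl_iff.1 hs).2
    rcases hst.eq_or_lt with rfl | hlt
    · exact ⟨s, mem_insert _ _, halive, h⟩
    · have hev : ∀ᶠ q in 𝓝[>] s, 𝔛.Z q ω ≠ OnePoint.infty :=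
        (𝔛.path_right ω s).mono Ioi_subset_Ici_self
          (OnePoint.isClosed_infty.isOpen_compl.mem_nhds halive)
      obtain ⟨u, hu, hus⟩ := mem_nhdsGT_iff_exists_Ioo_subset.1 hev
      obtain ⟨q, hqD, hsq, hq⟩ := hD.exists_between (lt_min hlt hu)
      exact ⟨q, .inr ⟨hqD, (hq.trans_le (min_le_left _ _)).le⟩,
        hus ⟨hsq, hq.trans_le (min_le_right _ _)⟩,
        (𝔛.exitTime_le_of_mem hs).trans (ENNReal.coe_le_coe.2 hsq.le)⟩
  · rintro ⟨q, rfl | hq, -, h⟩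
    · exact h
    · exact h.trans (ENNReal.coe_le_coe.2 hq.2)

variable [T2Space X] [LocallyCompactSpace X] [SecondCountableTopology X]

theorem IsDiffusion.measurableSet_alive_and_exitTime_le (hd : 𝔛.IsDiffusion) {U : Set X}
    (hU : IsOpen U) {q : ℝ≥0} (hm : ∀ s ≤ q, Measurable[m] (𝔛.Z s)) :
    MeasurableSet[m] {ω | 𝔛.Z q ω ≠ OnePoint.infty ∧ 𝔛.exitTime U ω ≤ q} := by
  let _ := TopologicalSpace.metrizableSpaceMetric (OnePoint X)
  set F : Set (OnePoint X) := ((↑) '' U)ᶜ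
  have hFclosed : IsClosed F := (OnePoint.isOpen_image_coe.2 hU).isClosed_compl
  have hFne : F.Nonempty := ⟨OnePoint.infty, OnePoint.infty_notMem_image_coe⟩
  obtain ⟨D, hDq, hDc, hqD⟩ :=
    (TopologicalSpace.IsSeparable.of_separableSpace (Iic q)).exists_countable_dense_subset
  have hiff : ∀ ω, 𝔛.Z q ω ≠ OnePoint.infty → (𝔛.exitTime U ω ≤ q ↔
      ∀ n : ℕ, ∃ d ∈ D, Metric.infDist (𝔛.Z d ω) F < 1 / ((n : ℝ) + 1)) := fun ω hω => by
    have halive : ∀ s ≤ q, 𝔛.Z s ω ≠ OnePoint.infty := fun s hs => 𝔛.Z_ne_infty_of_le hs hω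
    rw [𝔛.exitTime_le_iff hU, ← exists_mem_isClosed_iff_forall_exists_infDist_lt
      (Icc_bot (a := q) ▸ isCompact_Icc) hDq hqD ((hd ω).mono halive) hFclosed hFne]
    exact exists_congr fun s => and_congr_right fun hs =>
      mem_image_coe_compl_iff.trans (and_iff_left (halive s hs))
  have hset : {ω | 𝔛.Z q ω ≠ OnePoint.infty ∧ 𝔛.exitTime U ω ≤ q} =
      {ω | 𝔛.Z q ω ≠ OnePoint.infty} ∩
        ⋂ n : ℕ, ⋃ d ∈ D, {ω | Metric.infDist (𝔛.Z d ω) F < 1 / ((n : ℝ) + 1)} := by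
    ext ω
    simpa only [mem_inter_iff, mem_iInter, mem_iUnion, exists_prop, mem_ofPred_eq] using
      and_congr_right (hiff ω)
  rw [hset]
  refine (hm q le_rfl OnePoint.isClosed_infty.measurableSet.compl).inter ?_
  exact MeasurableSet.iInter fun n => MeasurableSet.biUnion hDc fun d hdD =>
    (Metric.continuous_infDist_pt F).measurable.comp (hm d (hDq hdD)) measurableSet_Iio

-- A path may leave `U` and die before time `t`, and it is continuous only while it is alive:
-- hence the countably many times `q` at which the path is required to be alive.
theorem IsDiffusion.measurableSet_exitTime_le (hd : 𝔛.IsDiffusion) {U : Set X} (hU : IsOpen U)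
    {t : ℝ≥0} (hm : ∀ s ≤ t, Measurable[m] (𝔛.Z s)) :
    MeasurableSet[m] {ω | 𝔛.exitTime U ω ≤ t} := by
  obtain ⟨D, hDc, hD⟩ := TopologicalSpace.exists_countable_dense ℝ≥0
  have hset : {ω | 𝔛.exitTime U ω ≤ t} = ⋃ q ∈ insert t (D ∩ Iic t),
      {ω | 𝔛.Z q ω ≠ OnePoint.infty ∧ 𝔛.exitTime U ω ≤ q} := by
    ext ω
    simpa only [mem_iUnion, exists_prop, mem_ofPred_eq] using exitTime_le_iff_exists_dense hU hD
  rw [hset]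
  refine MeasurableSet.biUnion ((hDc.mono inter_subset_left).insert t) fun q hq => ?_
  have hqt : q ≤ t := hq.elim (fun h => h.le) fun h => h.2
  exact hd.measurableSet_alive_and_exitTime_le hU fun s hs => hm s (hs.trans hqt)

end ExitTimeMeasurability

section StrongMarkov

variable {X : Type*} [TopologicalSpace X] {Ω : Type*} [mΩ : MeasurableSpace Ω]
  (𝔛 : HuntProcess X Ω)

/-- The σ-algebra on `Ω` generated by the process. -/
abbrev pathSigma : MeasurableSpace Ω :=
  ⨆ t, MeasurableSpace.comap (𝔛.Z t) (onePointMeasurableSpace X)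

theorem measurable_Z_pathSigma (t : ℝ≥0) : Measurable[𝔛.pathSigma] (𝔛.Z t) :=
  measurable_iff_comap_le.2 (le_iSup (fun t => MeasurableSpace.comap (𝔛.Z t) _) t)

theorem measurable_Z (t : ℝ≥0) : Measurable (𝔛.Z t) :=
  (𝔛.adapted t).mono (𝔛.𝓜.le t) le_rfl

theorem pathSigma_le : 𝔛.pathSigma ≤ mΩ :=
  iSup_le fun t => measurable_iff_comap_le.1 (𝔛.measurable_Z t)

theorem measurable_trim_P :
    Measurable[_, @Measure.instMeasurableSpace Ω 𝔛.pathSigma]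
      fun z => (𝔛.P z).trim 𝔛.pathSigma_le := by
  refine @Measure.measurable_of_measurable_coe _ _ 𝔛.pathSigma _ _ fun A hA => ?_
  simp only [trim_measurableSet_eq 𝔛.pathSigma_le hA]
  exact 𝔛.measurable_P A hA

theorem measurable_lintegral_P {f : Ω → ℝ≥0∞} (hf : Measurable[𝔛.pathSigma] f) :
    Measurable fun z => ∫⁻ ω, f ω ∂(𝔛.P z) := by
  simp only [← lintegral_trim 𝔛.pathSigma_le hf]
  exact (@Measure.measurable_lintegral _ 𝔛.pathSigma f hf).comp 𝔛.measurable_trim_P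

variable [T2Space X] [LocallyCompactSpace X] [SecondCountableTopology X]

theorem measurable_shift {T : Ω → ℝ≥0∞} (hT : Measurable T) :
    Measurable[mΩ, 𝔛.pathSigma] fun ω => 𝔛.θ (T ω).toNNReal ω := by
  refine Measurable.of_comap_le ?_
  simp only [MeasurableSpace.comap_iSup, MeasurableSpace.comap_comp]
  refine iSup_le fun s => measurable_iff_comap_le.1 ?_
  simpa only [Function.comp_def, 𝔛.shift] using measurable_eval_randomTime 𝔛.measurable_Z
    𝔛.path_right (hT.ennreal_toNNReal.const_add s)

theorem setLIntegral_shift {T : Ω → ℝ≥0∞} (hT : IsStoppingTime 𝔛.𝓜 T) (hTm : Measurable T)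
    (x : OnePoint X) {f : Ω → ℝ≥0∞} (hf : Measurable[𝔛.pathSigma] f) :
    ∫⁻ ω in {ω | T ω ≠ ⊤}, f (𝔛.θ (T ω).toNNReal ω) ∂(𝔛.P x) =
      ∫⁻ ω in {ω | T ω ≠ ⊤}, ∫⁻ ω', f ω' ∂(𝔛.P (stateAt 𝔛.Z T ω)) ∂(𝔛.P x) := by
  have hlaw : Measurable[mΩ, @Measure.instMeasurableSpace Ω 𝔛.pathSigma] fun ω =>
      (𝔛.P (stateAt 𝔛.Z T ω)).trim 𝔛.pathSigma_le :=
    𝔛.measurable_trim_P.comp (measurable_stateAt 𝔛.measurable_Z 𝔛.path_right hTm)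
  simp only [← lintegral_trim 𝔛.pathSigma_le hf]
  refine @lintegral_comp_eq_lintegral_lintegral Ω Ω mΩ 𝔛.pathSigma _ _ _
    (𝔛.measurable_shift hTm) hlaw (fun A hA => ?_) f hf
  have hpre := 𝔛.measurable_shift hTm hA
  rw [Measure.restrict_apply hpre, inter_comm]
  simpa only [mem_univ, true_and, inter_def, mem_preimage, mem_ofPred_eq,
    trim_measurableSet_eq 𝔛.pathSigma_le hA] using
    𝔛.strongMarkov T hT x univ A MeasurableSet.univ hA

end StrongMarkov

end HuntProcess

namespace HuntProcess

section ExitTime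

variable {X : Type*} [TopologicalSpace X] {Ω : Type*} [mΩ : MeasurableSpace Ω]
  {𝔛 : HuntProcess X Ω}

theorem exitTime_eq_zero_ae {U : Set X} {x : X} (hx : x ∉ U) :
    ∀ᵐ ω ∂(𝔛.P x), 𝔛.exitTime U ω = 0 := by
  filter_upwards [𝔛.start x] with ω hω
  have hmem : 𝔛.Z 0 ω ∈ ((↑) '' Uᶜ : Set (OnePoint X)) := hω ▸ mem_image_of_mem _ hx
  exact nonpos_iff_eq_zero.1 (𝔛.exitTime_le_of_mem hmem)

theorem exitTime_pos_ae {U : Set X} (hU : IsOpen U) {x : X} (hx : x ∈ U) :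
    ∀ᵐ ω ∂(𝔛.P x), 0 < 𝔛.exitTime U ω := by
  filter_upwards [𝔛.start x] with ω hω
  refine pos_of_ne_zero fun h => ?_
  have hmem := 𝔛.Z_exitTime_mem hU (h ▸ ENNReal.zero_ne_top)
  rw [h, ENNReal.toNNReal_zero, hω, mem_image_coe_compl_iff] at hmem
  exact hmem.1 (mem_image_of_mem _ hx)

theorem expectedExitTime_eq_zero {U : Set X} {x : X} (hx : x ∉ U) :
    𝔛.expectedExitTime U x = 0 := by
  rw [expectedExitTime, lintegral_congr_ae (exitTime_eq_zero_ae hx), lintegral_zero]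

theorem exitKernel_eq_dirac [MeasurableSpace X] [BorelSpace X] {U : Set X} {x : X}
    (hx : x ∉ U) : 𝔛.exitKernel U x = Measure.dirac x := by
  have hstate : 𝔛.exitState U =ᵐ[𝔛.P x] fun _ => x := by
    filter_upwards [𝔛.start x, exitTime_eq_zero_ae hx] with ω hstart hτ
    rw [𝔛.exitState_of_ne_top (hτ ▸ ENNReal.zero_ne_top), hτ, ENNReal.toNNReal_zero, hstart]
  have := 𝔛.isProbabilityMeasure x
  have hmap : (𝔛.P x).map (𝔛.exitState U) =
      (Measure.dirac x).map ((↑) : X → OnePoint X) := by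
    rw [Measure.map_congr hstate, Measure.map_const, measure_univ, one_smul,
      Measure.map_dirac' measurableEmbedding_onePoint_coe.measurable]
  change ((𝔛.P x).map (𝔛.exitState U)).comap ((↑) : X → OnePoint X) = _
  rw [hmap, measurableEmbedding_onePoint_coe.comap_map]

variable [T2Space X] [LocallyCompactSpace X] [SecondCountableTopology X]

namespace IsDiffusion

variable (hd : 𝔛.IsDiffusion) {U W : Set X} (hU : IsOpen U)
include hd hU

theorem isStoppingTime_exitTime : IsStoppingTime 𝔛.𝓜 (𝔛.exitTime U) := fun _ =>
  hd.measurableSet_exitTime_le hU fun s hs => (𝔛.adapted s).mono (𝔛.𝓜.mono hs) le_rfl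

theorem measurable_exitTime_pathSigma : Measurable[𝔛.pathSigma] (𝔛.exitTime U) := by
  refine @measurable_of_Iic _ _ _ _ _ 𝔛.pathSigma _ _ _ _ fun a => ?_
  induction a using ENNReal.recTopCoe with
  | top => simp only [Iic_top, preimage_univ, MeasurableSet.univ]
  | coe t => exact hd.measurableSet_exitTime_le hU fun s _ => 𝔛.measurable_Z_pathSigma s

theorem measurable_exitTime : Measurable (𝔛.exitTime U) :=
  (hd.measurable_exitTime_pathSigma hU).mono 𝔛.pathSigma_le le_rfl

theorem measurable_exitState_pathSigma : Measurable[𝔛.pathSigma] (𝔛.exitState U) :=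
  @measurable_stateAt _ _ _ _ _ _ 𝔛.pathSigma _ 𝔛.measurable_Z_pathSigma 𝔛.path_right _
    (hd.measurable_exitTime_pathSigma hU)

theorem measurable_exitState : Measurable (𝔛.exitState U) :=
  (hd.measurable_exitState_pathSigma hU).mono 𝔛.pathSigma_le le_rfl

theorem measurableSet_exitTime_ne_top : MeasurableSet {ω | 𝔛.exitTime U ω ≠ ⊤} :=
  (hd.measurable_exitTime hU (measurableSet_singleton ⊤)).compl

theorem expectedExitTime_pos {x : X} (hx : x ∈ U) : 0 < 𝔛.expectedExitTime U x := by
  have := 𝔛.isProbabilityMeasure x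
  refine pos_of_ne_zero fun h => ?_
  have hzero := (lintegral_eq_zero_iff (hd.measurable_exitTime hU)).1 h
  obtain ⟨ω, hω, hpos⟩ := (hzero.and (exitTime_pos_ae hU hx)).exists
  exact hpos.ne' hω

theorem measurable_expectedExitTime [MeasurableSpace X] [BorelSpace X] :
    Measurable (𝔛.expectedExitTime U) :=
  (𝔛.measurable_lintegral_P (hd.measurable_exitTime_pathSigma hU)).comp
    OnePoint.continuous_coe.measurable

end IsDiffusion

end ExitTime

section ExitKernel

variable {X : Type*} [TopologicalSpace X] [T2Space X] [LocallyCompactSpace X]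
  [SecondCountableTopology X] [MeasurableSpace X] [BorelSpace X] {Ω : Type*}
  [mΩ : MeasurableSpace Ω] {𝔛 : HuntProcess X Ω} (hd : 𝔛.IsDiffusion) {U V W : Set X}

namespace IsDiffusion

include hd

theorem exitKernel_apply (hU : IsOpen U) (x : X) {B : Set X} (hB : MeasurableSet B) :
    𝔛.exitKernel U x B = 𝔛.P x (𝔛.exitState U ⁻¹' ((↑) '' B)) := by
  rw [exitKernel, measurableEmbedding_onePoint_coe.comap_apply]
  exact Measure.map_apply (hd.measurable_exitState hU)
    (measurableEmbedding_onePoint_coe.measurableSet_image.2 hB)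

theorem lintegral_exitKernel (hU : IsOpen U) (x : X) {g : OnePoint X → ℝ≥0∞}
    (hg : Measurable g) :
    ∫⁻ y, g y ∂(𝔛.exitKernel U x) =
      ∫⁻ ω in {ω | 𝔛.exitTime U ω ≠ ⊤}, g (𝔛.exitState U ω) ∂(𝔛.P x) := by
  have hcoe : MeasurableEmbedding ((↑) : X → OnePoint X) := measurableEmbedding_onePoint_coe
  have hrange : 𝔛.exitState U ⁻¹' range ((↑) : X → OnePoint X) = {ω | 𝔛.exitTime U ω ≠ ⊤} :=
    ext fun _ => 𝔛.exitState_mem_range_iff hU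
  have hstate := hd.measurable_exitState hU
  calc ∫⁻ y, g y ∂(𝔛.exitKernel U x)
      = ∫⁻ z in range ((↑) : X → OnePoint X), g z ∂((𝔛.P x).map (𝔛.exitState U)) := by
        rw [← hcoe.map_comap, hcoe.lintegral_map]
        rfl
    _ = ∫⁻ ω in {ω | 𝔛.exitTime U ω ≠ ⊤}, g (𝔛.exitState U ω) ∂(𝔛.P x) := by
        rw [Measure.restrict_map hstate hcoe.measurableSet_range, hrange, lintegral_map hg hstate]

theorem measurable_exitKernel (hU : IsOpen U) : Measurable (𝔛.exitKernel U) := by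
  refine Measure.measurable_of_measurable_coe _ fun B hB => ?_
  simp only [hd.exitKernel_apply hU _ hB]
  have hpre := hd.measurable_exitState_pathSigma hU
    (measurableEmbedding_onePoint_coe.measurableSet_image.2 hB)
  exact (𝔛.measurable_P _ hpre).comp OnePoint.continuous_coe.measurable

theorem exitKernel_compl_frontier (hU : IsOpen U) {x : X} (hx : x ∈ U) :
    𝔛.exitKernel U x (frontier U)ᶜ = 0 := by
  rw [hd.exitKernel_apply hU x isClosed_frontier.measurableSet.compl]
  refine measure_eq_zero_iff_ae_notMem.2 ((exitTime_pos_ae hU hx).mono fun ω hpos => ?_)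
  rintro ⟨y, hy, hyω⟩
  have hτ : 𝔛.exitTime U ω ≠ ⊤ := (𝔛.exitState_mem_range_iff hU).1 ⟨y, hyω⟩
  have hclosure := hd.exitState_mem_closure hU hτ hpos
  have hcompl := 𝔛.Z_exitTime_mem hU hτ
  rw [← 𝔛.exitState_of_ne_top hτ, ← hyω, OnePoint.coe_injective.mem_set_image] at hcompl
  rw [← hyω, ← mem_preimage,
    ← OnePoint.isOpenEmbedding_coe.isInducing.closure_eq_preimage_closure_image] at hclosure
  exact hy ⟨hclosure, by rwa [hU.interior_eq]⟩

theorem isBoundaryKernel_exitKernel (hU : IsOpen U) : IsBoundaryKernel (𝔛.exitKernel U) U :=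
  ⟨hd.measurable_exitKernel hU, fun _ => hd.exitKernel_compl_frontier hU,
    fun _ => exitKernel_eq_dirac⟩

theorem ae_exitKernel_mem_frontier (hU : IsOpen U) {x : X} (hx : x ∈ U) :
    ∀ᵐ y ∂(𝔛.exitKernel U x), y ∈ frontier U :=
  mem_ae_iff.2 (hd.exitKernel_compl_frontier hU hx)

theorem exitKernel_univ (hU : IsOpen U) {x : X} (h : 𝔛.expectedExitTime U x ≠ ⊤) :
    𝔛.exitKernel U x univ = 1 := by
  have := 𝔛.isProbabilityMeasure x
  have hrange : MeasurableSet (𝔛.exitState U ⁻¹' range ((↑) : X → OnePoint X)) :=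
    hd.measurable_exitState hU measurableEmbedding_onePoint_coe.measurableSet_range
  rw [hd.exitKernel_apply hU x MeasurableSet.univ, image_univ, ← mem_ae_iff_prob_eq_one hrange]
  exact (ae_lt_top (hd.measurable_exitTime hU) h).mono fun ω hω =>
    (𝔛.exitState_mem_range_iff hU).2 hω.ne

theorem setLIntegral_shift_exitTime (hW : IsOpen W) (x : X) {f : Ω → ℝ≥0∞}
    (hf : Measurable[𝔛.pathSigma] f) :
    ∫⁻ ω in {ω | 𝔛.exitTime W ω ≠ ⊤}, f (𝔛.θ (𝔛.exitTime W ω).toNNReal ω) ∂(𝔛.P x) =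
      ∫⁻ y, ∫⁻ ω, f ω ∂(𝔛.P y) ∂(𝔛.exitKernel W x) := by
  rw [hd.lintegral_exitKernel hW x (𝔛.measurable_lintegral_P hf)]
  exact 𝔛.setLIntegral_shift (hd.isStoppingTime_exitTime hW) (hd.measurable_exitTime hW) x hf

theorem expectedExitTime_add_lintegral_exitKernel (hU : IsOpen U) (hW : IsOpen W) (x : X) :
    𝔛.expectedExitTime W x + ∫⁻ y, 𝔛.expectedExitTime U y ∂(𝔛.exitKernel W x) =
      ∫⁻ ω, 𝔛.exitTime W ω + {ω | 𝔛.exitTime W ω ≠ ⊤}.indicator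
        (fun ω => 𝔛.exitTime U (𝔛.θ (𝔛.exitTime W ω).toNNReal ω)) ω ∂(𝔛.P x) := by
  rw [lintegral_add_left (hd.measurable_exitTime hW),
    lintegral_indicator (hd.measurableSet_exitTime_ne_top hW),
    hd.setLIntegral_shift_exitTime hW x (hd.measurable_exitTime_pathSigma hU)]
  rfl

theorem expectedExitTime_le_add_lintegral (hU : IsOpen U) (hW : IsOpen W) (x : X) :
    𝔛.expectedExitTime U x ≤
      𝔛.expectedExitTime W x + ∫⁻ y, 𝔛.expectedExitTime U y ∂(𝔛.exitKernel W x) := by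
  rw [hd.expectedExitTime_add_lintegral_exitKernel hU hW]
  refine lintegral_mono fun ω => ?_
  by_cases h : 𝔛.exitTime W ω = ⊤
  · simp only [h, top_add, le_top]
  · rw [indicator_of_mem (mem_ofPred_eq ▸ h)]
    simpa only [ENNReal.coe_toNNReal h] using
      𝔛.exitTime_le_add_shift hU (𝔛.exitTime W ω).toNNReal ω

theorem expectedExitTime_eq_add_lintegral (hW : IsOpen W) (hV : IsOpen V) (hWV : W ⊆ V)
    (x : X) :
    𝔛.expectedExitTime V x =
      𝔛.expectedExitTime W x + ∫⁻ y, 𝔛.expectedExitTime V y ∂(𝔛.exitKernel W x) := by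
  rw [hd.expectedExitTime_add_lintegral_exitKernel hV hW]
  refine lintegral_congr fun ω => ?_
  have hle := 𝔛.exitTime_anti hWV ω
  by_cases h : 𝔛.exitTime W ω = ⊤
  · rw [h, top_add]
    exact top_le_iff.1 (h ▸ hle)
  · rw [indicator_of_mem (mem_ofPred_eq ▸ h)]
    have hadd := 𝔛.exitTime_eq_add_shift hV ((ENNReal.coe_toNNReal h).trans_le hle)
    rwa [ENNReal.coe_toNNReal h] at hadd

theorem lintegral_exitKernel_exitKernel (hW : IsOpen W) (hV : IsOpen V) (hWV : W ⊆ V) (x : X)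
    {B : Set X} (hB : MeasurableSet B) :
    ∫⁻ y, 𝔛.exitKernel V y B ∂(𝔛.exitKernel W x) = 𝔛.exitKernel V x B := by
  have hApath : MeasurableSet[𝔛.pathSigma] (𝔛.exitState V ⁻¹' ((↑) '' B)) :=
    hd.measurable_exitState_pathSigma hV
      (measurableEmbedding_onePoint_coe.measurableSet_image.2 hB)
  simp only [hd.exitKernel_apply hV _ hB]
  set A := 𝔛.exitState V ⁻¹' ((↑) '' B)
  have hAind : Measurable[𝔛.pathSigma] (A.indicator (1 : Ω → ℝ≥0∞)) :=
    Measurable.indicator (m := 𝔛.pathSigma) measurable_const hApath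
  have hA : MeasurableSet A := 𝔛.pathSigma_le A hApath
  have hAW : A ⊆ {ω | 𝔛.exitTime W ω ≠ ⊤} := fun ω hω => ne_top_of_le_ne_top
    ((𝔛.exitState_mem_range_iff hV).1 (image_subset_range _ _ hω)) (𝔛.exitTime_anti hWV ω)
  have hshift : ∀ ω, 𝔛.exitTime W ω ≠ ⊤ →
      A.indicator 1 (𝔛.θ (𝔛.exitTime W ω).toNNReal ω) = A.indicator (1 : Ω → ℝ≥0∞) ω :=
    fun ω hω => indicator_eq_indicator (by
      rw [mem_preimage, mem_preimage, 𝔛.exitState_shift hV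
        ((ENNReal.coe_toNNReal hω).trans_le (𝔛.exitTime_anti hWV ω))]) rfl
  calc ∫⁻ y, 𝔛.P y A ∂(𝔛.exitKernel W x)
      = ∫⁻ y, ∫⁻ ω, A.indicator 1 ω ∂(𝔛.P y) ∂(𝔛.exitKernel W x) := by
        simp only [lintegral_indicator_one hA]
    _ = ∫⁻ ω in {ω | 𝔛.exitTime W ω ≠ ⊤},
          A.indicator 1 (𝔛.θ (𝔛.exitTime W ω).toNNReal ω) ∂(𝔛.P x) :=
        (hd.setLIntegral_shift_exitTime hW x hAind).symm
    _ = ∫⁻ ω in {ω | 𝔛.exitTime W ω ≠ ⊤}, A.indicator 1 ω ∂(𝔛.P x) :=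
        setLIntegral_congr_fun (hd.measurableSet_exitTime_ne_top hW) hshift
    _ = 𝔛.P x A := by
        rw [lintegral_indicator_one hA, Measure.restrict_apply hA, inter_eq_left.2 hAW]

end IsDiffusion

end ExitKernel

end HuntProcess

theorem erealIntegral_coe_ennreal {X : Type*} [MeasurableSpace X] (μ : Measure X) (g : X → ℝ≥0∞) :
    erealIntegral μ (fun x => (g x : EReal)) = ((∫⁻ x, g x ∂μ : ℝ≥0∞) : EReal) := by
  have hneg : ∀ x, (-(g x : EReal)).toENNReal = 0 := fun x =>
    EReal.toENNReal_of_nonpos (EReal.neg_le_zero.2 (EReal.coe_ennreal_nonneg _))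
  simp only [erealIntegral, hneg, EReal.toENNReal_coe, lintegral_zero, EReal.coe_ennreal_zero,
    sub_zero]

theorem isLocallyHyperharmonic_coe_ennreal {X : Type*} [TopologicalSpace X] [MeasurableSpace X]
    {H : Set X → X → Measure X} {𝓦 : X → Set (Set X)} {U : Set X} {g : X → ℝ≥0∞}
    (hg : LowerSemicontinuousOn g U) (h : ∀ x ∈ U, ∀ W ∈ 𝓦 x, ∫⁻ y, g y ∂(H W x) ≤ g x) :
    IsLocallyHyperharmonic H 𝓦 U (fun x => (g x : EReal)) := by
  refine ⟨continuous_coe_ennreal_ereal.comp_lowerSemicontinuousOn hg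
    EReal.coe_ennreal_strictMono.monotone, fun x _ => EReal.coe_ennreal_ne_bot _,
    fun x hx W hW => ?_⟩
  rw [erealIntegral_coe_ennreal]
  exact EReal.coe_ennreal_le_coe_ennreal_iff.2 (h x hx W hW)

theorem isLocalChoice_of_isTopologicalBasis {X : Type*} [TopologicalSpace X] [RegularSpace X]
    {𝓥 : Set (Set X)} (h𝓥 : TopologicalSpace.IsTopologicalBasis 𝓥) {V : Set X} (hV : IsOpen V) :
    IsLocalChoice 𝓥 V fun x => {W | W ∈ 𝓥 ∧ closure W ⊆ V ∧ x ∈ W} := by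
  refine fun x hx => ⟨fun W hW => ⟨hW.1, hW.2.1⟩, ⟨fun s => ⟨fun hs => ?_, ?_⟩⟩⟩
  · obtain ⟨W, hW, hxW, hWs⟩ := h𝓥.exists_closure_subset (inter_mem hs (hV.mem_nhds hx))
    exact ⟨W, ⟨hW, hWs.trans inter_subset_right, hxW⟩,
      subset_closure.trans (hWs.trans inter_subset_left)⟩
  · rintro ⟨W, ⟨hW, -, hxW⟩, hWs⟩
    exact mem_of_superset ((h𝓥.isOpen hW).mem_nhds hxW) hWs

theorem coe_ennreal_add_sub_cancel_right (a : ℝ≥0∞) {b : ℝ≥0∞} (hb : b ≠ ⊤) :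
    ((a + b : ℝ≥0∞) : EReal) - b = a := by
  lift b to ℝ≥0 using hb
  rw [EReal.coe_ennreal_add]
  exact EReal.add_sub_cancel_right

namespace HuntProcess

section ExpectedExitTime

variable {X : Type*} [TopologicalSpace X] {Ω : Type*} [mΩ : MeasurableSpace Ω]
  {𝔛 : HuntProcess X Ω} {V : Set X}

theorem D1.expectedExitTime_ne_top (h1 : 𝔛.D1 V) (x : X) : 𝔛.expectedExitTime V x ≠ ⊤ := by
  by_cases hx : x ∈ V
  · exact h1.2.1 x hx
  · rw [expectedExitTime_eq_zero hx]
    exact ENNReal.zero_ne_top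

theorem D1.continuous_expectedExitTime (h1 : 𝔛.D1 V) (hV : IsOpen V) :
    Continuous (𝔛.expectedExitTime V) := by
  refine continuous_of_continuousOn_of_tendsto_frontier hV h1.2.2.1
    (continuousOn_const.congr fun x hx => expectedExitTime_eq_zero hx) fun z hz => ?_
  rw [expectedExitTime_eq_zero (hV.frontier_eq ▸ hz).2]
  exact h1.2.2.2 z hz

theorem D1.isCompact_frontier (h1 : 𝔛.D1 V) : IsCompact (frontier V) :=
  h1.1.of_isClosed_subset isClosed_frontier frontier_subset_closure

end ExpectedExitTime

section BauerDiffusion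

variable {X : Type*} [TopologicalSpace X] [T2Space X] [LocallyCompactSpace X]
  [SecondCountableTopology X] [MeasurableSpace X] [BorelSpace X] {Ω : Type*}
  [mΩ : MeasurableSpace Ω] {𝔛 : HuntProcess X Ω} (hd : 𝔛.IsDiffusion) {U V W : Set X}

namespace IsDiffusion

include hd

theorem isProbabilityMeasure_exitKernel (hV : IsOpen V) {x : X}
    (h : 𝔛.expectedExitTime V x ≠ ⊤) : IsProbabilityMeasure (𝔛.exitKernel V x) :=
  ⟨hd.exitKernel_univ hV h⟩

theorem ae_eq_exitKernel_of_eqOn_frontier (hV : IsOpen V) {x : X} (hx : x ∈ V) {f g : X → ℝ}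
    (h : EqOn f g (frontier V)) : f =ᵐ[𝔛.exitKernel V x] g :=
  (hd.ae_exitKernel_mem_frontier hV hx).mono h

theorem integrable_exitKernel (hV : IsOpen V) (h1 : 𝔛.D1 V) {f : X → ℝ} (hf : Continuous f)
    (x : X) : Integrable f (𝔛.exitKernel V x) := by
  have := hd.isProbabilityMeasure_exitKernel hV (h1.expectedExitTime_ne_top x)
  by_cases hx : x ∈ V
  · obtain ⟨g, hg⟩ := exists_boundedContinuousFunction_eqOn h1.isCompact_frontier hf
    exact (g.integrable _).congr (hd.ae_eq_exitKernel_of_eqOn_frontier hV hx hg)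
  · rw [exitKernel_eq_dirac hx]
    exact integrable_dirac enorm_lt_top

theorem tendsto_integral_exitKernel (hV : IsOpen V) (h1 : 𝔛.D1 V) (h2 : 𝔛.D2 V)
    (g : BoundedContinuousFunction X ℝ) {z : X} (hz : z ∈ frontier V) :
    Tendsto (fun x => ∫ y, g y ∂(𝔛.exitKernel V x)) (𝓝[V] z) (𝓝 (g z)) := by
  let μ : X → ProbabilityMeasure X := fun x =>
    ⟨𝔛.exitKernel V x, hd.isProbabilityMeasure_exitKernel hV (h1.expectedExitTime_ne_top x)⟩
  have hμ : Tendsto μ (𝓝[V] z) (𝓝 (diracProba z)) :=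
    tendsto_diracProba_of_tendsto_measure_compl fun W hW hzW =>
      (h2.1 z hz W hW hzW).mono_left nhdsWithin_le_nhds
  have hint := ProbabilityMeasure.tendsto_iff_forall_integral_tendsto.1 hμ g
  rwa [diracProba, ProbabilityMeasure.coe_mk, integral_dirac] at hint

theorem continuous_integral_exitKernel (hV : IsOpen V) (h1 : 𝔛.D1 V) (h2 : 𝔛.D2 V) {f : X → ℝ}
    (hf : Continuous f) : Continuous fun x => ∫ y, f y ∂(𝔛.exitKernel V x) := by
  obtain ⟨g, hg⟩ := exists_boundedContinuousFunction_eqOn h1.isCompact_frontier hf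
  have hin : EqOn (fun x => ∫ y, f y ∂(𝔛.exitKernel V x))
      (fun x => ∫ y, g y ∂(𝔛.exitKernel V x)) V := fun x hx =>
    integral_congr_ae (hd.ae_eq_exitKernel_of_eqOn_frontier hV hx hg.symm)
  have hout : EqOn (fun x => ∫ y, f y ∂(𝔛.exitKernel V x)) f Vᶜ := fun x hx => by
    simp only [exitKernel_eq_dirac hx, integral_dirac]
  have hg_cont := h2.2 g g.continuous.measurable ⟨‖g‖, g.norm_coe_le_norm⟩
  refine continuous_of_continuousOn_of_tendsto_frontier hV (hg_cont.congr hin)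
    (hf.continuousOn.congr hout) fun z hz => ?_
  have hz_out : ∫ y, f y ∂(𝔛.exitKernel V z) = g z :=
    (hout (hV.frontier_eq ▸ hz).2).trans (hg hz).symm
  rw [hz_out]
  exact (hd.tendsto_integral_exitKernel hV h1 h2 g hz).congr'
    (eventually_mem_nhdsWithin.mono fun x hx => (hin hx).symm)

theorem continuous_lintegral_expectedExitTime (hU : IsOpen U) (hV : IsOpen V) (hU1 : 𝔛.D1 U)
    (hU2 : 𝔛.D2 U) (hV1 : 𝔛.D1 V) :
    Continuous fun x => ∫⁻ y, 𝔛.expectedExitTime V y ∂(𝔛.exitKernel U x) := by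
  have hfin := hV1.expectedExitTime_ne_top
  have hp : Continuous fun y => (𝔛.expectedExitTime V y).toReal :=
    ENNReal.continuousOn_toReal.comp_continuous (hV1.continuous_expectedExitTime hV) hfin
  have hint : ∀ x, ENNReal.ofReal (∫ y, (𝔛.expectedExitTime V y).toReal ∂(𝔛.exitKernel U x)) =
      ∫⁻ y, 𝔛.expectedExitTime V y ∂(𝔛.exitKernel U x) := fun x => by
    rw [ofReal_integral_eq_lintegral_ofReal (hd.integrable_exitKernel hU hU1 hp x)
      (.of_forall fun _ => ENNReal.toReal_nonneg)]
    simp only [ENNReal.ofReal_toReal (hfin _)]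
  exact (ENNReal.continuous_ofReal.comp
    (hd.continuous_integral_exitKernel hU hU1 hU2 hp)).congr hint

theorem lintegral_expectedExitTime_ne_top (hU : IsOpen U) (hV : IsOpen V) (hUV : U ⊆ V)
    {x : X} (h : 𝔛.expectedExitTime V x ≠ ⊤) :
    ∫⁻ y, 𝔛.expectedExitTime V y ∂(𝔛.exitKernel U x) ≠ ⊤ :=
  ne_top_of_le_ne_top h
    (le_add_self.trans_eq (hd.expectedExitTime_eq_add_lintegral hU hV hUV x).symm)

theorem lintegral_lintegral_expectedExitTime_le (hU : IsOpen U) (hV : IsOpen V) (hW : IsOpen W)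
    (hUV : U ⊆ V) (hWV : W ⊆ V) {x : X} (h : 𝔛.expectedExitTime U x ≠ ⊤) :
    ∫⁻ z, ∫⁻ y, 𝔛.expectedExitTime V y ∂(𝔛.exitKernel U z) ∂(𝔛.exitKernel W x) ≤
      ∫⁻ y, 𝔛.expectedExitTime V y ∂(𝔛.exitKernel U x) := by
  set q : X → ℝ≥0∞ := fun z => ∫⁻ y, 𝔛.expectedExitTime V y ∂(𝔛.exitKernel U z)
  have hpq : ∀ z, 𝔛.expectedExitTime V z = 𝔛.expectedExitTime U z + q z :=
    hd.expectedExitTime_eq_add_lintegral hU hV hUV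
  refine (ENNReal.add_le_add_iff_left h).1 ?_
  calc 𝔛.expectedExitTime U x + ∫⁻ z, q z ∂(𝔛.exitKernel W x)
      ≤ 𝔛.expectedExitTime W x + ∫⁻ z, 𝔛.expectedExitTime U z ∂(𝔛.exitKernel W x) +
          ∫⁻ z, q z ∂(𝔛.exitKernel W x) := by
        gcongr
        exact hd.expectedExitTime_le_add_lintegral hU hW x
    _ = 𝔛.expectedExitTime W x + ∫⁻ z, 𝔛.expectedExitTime V z ∂(𝔛.exitKernel W x) := by
        simp only [hpq]
        rw [add_assoc, lintegral_add_left (hd.measurable_expectedExitTime hU)]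
    _ = 𝔛.expectedExitTime U x + q x := by
        rw [← hd.expectedExitTime_eq_add_lintegral hW hV hWV x, hpq]

theorem isHyperharmonic_expectedExitTime {𝓥 : Set (Set X)} (h𝓥 : ∀ W ∈ 𝓥, IsOpen W)
    (hV : IsOpen V) (hV1 : 𝔛.D1 V) :
    IsHyperharmonic 𝓥 𝔛.exitKernel V fun x => (𝔛.expectedExitTime V x : EReal) := by
  refine isLocallyHyperharmonic_coe_ennreal
    ((hV1.continuous_expectedExitTime hV).lowerSemicontinuous.lowerSemicontinuousOn V) ?_
  rintro x - W ⟨hW, hWV, -⟩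
  rw [hd.expectedExitTime_eq_add_lintegral (h𝓥 W hW) hV (subset_closure.trans hWV) x]
  exact le_add_self

theorem isHyperharmonic_lintegral_expectedExitTime {𝓥 : Set (Set X)}
    (h𝓥 : ∀ W ∈ 𝓥, IsOpen W) (hU : IsOpen U) (hV : IsOpen V) (hUV : U ⊆ V) (hU1 : 𝔛.D1 U)
    (hU2 : 𝔛.D2 U) (hV1 : 𝔛.D1 V) :
    IsHyperharmonic 𝓥 𝔛.exitKernel V fun x =>
      ((∫⁻ y, 𝔛.expectedExitTime V y ∂(𝔛.exitKernel U x) : ℝ≥0∞) : EReal) := by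
  refine isLocallyHyperharmonic_coe_ennreal ((hd.continuous_lintegral_expectedExitTime hU hV hU1
    hU2 hV1).lowerSemicontinuous.lowerSemicontinuousOn V) ?_
  rintro x - W ⟨hW, hWV, -⟩
  exact hd.lintegral_lintegral_expectedExitTime_le hU hV (h𝓥 W hW) hUV
    (subset_closure.trans hWV) (hU1.expectedExitTime_ne_top x)

theorem expectedExitTime_sub_lintegral (hU : IsOpen U) (hV : IsOpen V) (hUV : U ⊆ V)
    {x : X} (h : 𝔛.expectedExitTime V x ≠ ⊤) :
    (𝔛.expectedExitTime V x : EReal) -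
        ((∫⁻ y, 𝔛.expectedExitTime V y ∂(𝔛.exitKernel U x) : ℝ≥0∞) : EReal) =
      𝔛.expectedExitTime U x := by
  rw [hd.expectedExitTime_eq_add_lintegral hU hV hUV x]
  exact coe_ennreal_add_sub_cancel_right _ (hd.lintegral_expectedExitTime_ne_top hU hV hUV h)

theorem exists_isHyperharmonic_ne {𝓥 : Set (Set X)}
    (h𝓥 : TopologicalSpace.IsTopologicalBasis 𝓥) (hD : ∀ U ∈ 𝓥, 𝔛.D1 U ∧ 𝔛.D2 U) (hV : IsOpen V)
    (hV1 : 𝔛.D1 V) {x y : X} (hx : x ∈ V) (hxy : x ≠ y) :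
    ∃ u : X → EReal, IsHyperharmonic 𝓥 𝔛.exitKernel V u ∧ (∀ z, 0 ≤ u z) ∧ u x ≠ u y := by
  have hopen : ∀ W ∈ 𝓥, IsOpen W := fun _ => h𝓥.isOpen
  by_cases hp : 𝔛.expectedExitTime V x = 𝔛.expectedExitTime V y
  swap
  · exact ⟨_, hd.isHyperharmonic_expectedExitTime hopen hV hV1,
      fun _ => EReal.coe_ennreal_nonneg _, fun h => hp (EReal.coe_ennreal_injective h)⟩
  obtain ⟨U, hU, hxU, hUVy⟩ := h𝓥.exists_subset_of_mem_open (show x ∈ V ∩ {y}ᶜ from ⟨hx, hxy⟩)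
    (hV.inter isOpen_compl_singleton)
  obtain ⟨hUV, hyU⟩ := subset_inter_iff.1 hUVy
  rw [subset_compl_singleton_iff] at hyU
  refine ⟨_, hd.isHyperharmonic_lintegral_expectedExitTime hopen (hopen U hU) hV hUV
    (hD U hU).1 (hD U hU).2 hV1, fun _ => EReal.coe_ennreal_nonneg _, fun h => ?_⟩
  have hq := EReal.coe_ennreal_injective h
  have hfin := hd.lintegral_expectedExitTime_ne_top (hopen U hU) hV hUV
    (hV1.expectedExitTime_ne_top x)
  have hpU : 𝔛.expectedExitTime U x = 𝔛.expectedExitTime U y := by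
    have hadd := hd.expectedExitTime_eq_add_lintegral (hopen U hU) hV hUV
    rw [hadd x, hadd y, ← hq] at hp
    exact (ENNReal.add_left_inj hfin).1 hp
  exact (hd.expectedExitTime_pos (hopen U hU) hxU).ne' (hpU.trans (expectedExitTime_eq_zero hyU))

theorem isNormalBauerFamily_exitKernel {𝓥 : Set (Set X)}
    (h𝓥 : TopologicalSpace.IsTopologicalBasis 𝓥) (hD : ∀ V ∈ 𝓥, 𝔛.D1 V ∧ 𝔛.D2 V) :
    IsNormalBauerFamily 𝓥 𝔛.exitKernel where
  isTopologicalBasis := h𝓥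
  isCompact_closure V hV := (hD V hV).1.1
  isBoundaryKernel V hV := hd.isBoundaryKernel_exitKernel (h𝓥.isOpen hV)
  comp_eq V hV W hW hWV x _ :=
    hd.lintegral_exitKernel_exitKernel (h𝓥.isOpen hW) (h𝓥.isOpen hV) hWV x
  continuous V hV f hf :=
    ⟨hd.integrable_exitKernel (h𝓥.isOpen hV) (hD V hV).1 hf,
      hd.continuous_integral_exitKernel (h𝓥.isOpen hV) (hD V hV).1 (hD V hV).2 hf⟩
  normal V hV x := hd.exitKernel_univ (h𝓥.isOpen hV) ((hD V hV).1.expectedExitTime_ne_top x)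
  separates V hV := by
    refine ⟨_, isLocalChoice_of_isTopologicalBasis h𝓥 (h𝓥.isOpen hV), fun x hx y _ hxy => ?_⟩
    obtain ⟨u, hu, hnonneg, hne⟩ :=
      hd.exists_isHyperharmonic_ne h𝓥 hD (h𝓥.isOpen hV) (hD V hV).1 hx hxy
    exact ⟨u, hu, fun z _ => hnonneg z, hne⟩
  continuousOn V hV := (hD V hV).2.2

end IsDiffusion

end BauerDiffusion

end HuntProcess

theorem proposition1p3 {X : Type*} [TopologicalSpace X] [T2Space X] [LocallyCompactSpace X]
    [SecondCountableTopology X] [MeasurableSpace X] [BorelSpace X]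
    {Ω : Type*} [MeasurableSpace Ω] (𝔛 : HuntProcess X Ω) (h𝔛 : 𝔛.IsBauerDiffusion)
    (𝓥 : Set (Set X)) (h𝓥 : TopologicalSpace.IsTopologicalBasis 𝓥)
    (hD : ∀ V ∈ 𝓥, 𝔛.D1 V ∧ 𝔛.D2 V) :
    (∀ U ∈ 𝓥, ∀ V ∈ 𝓥, closure U ⊆ V →
      IsHyperharmonic 𝓥 𝔛.exitKernel V (fun x => (𝔛.expectedExitTime V x : EReal)) ∧
      IsHyperharmonic 𝓥 𝔛.exitKernel V
        (fun x => ((∫⁻ y, 𝔛.expectedExitTime V y ∂(𝔛.exitKernel U x) : ℝ≥0∞) : EReal)) ∧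
      ∀ x ∈ U,
        𝔛.expectedExitTime V x ≠ ⊤ ∧
        ∫⁻ y, 𝔛.expectedExitTime V y ∂(𝔛.exitKernel U x) ≠ ⊤ ∧
        (𝔛.expectedExitTime V x : EReal) -
            ((∫⁻ y, 𝔛.expectedExitTime V y ∂(𝔛.exitKernel U x) : ℝ≥0∞) : EReal) =
          (𝔛.expectedExitTime U x : EReal) ∧
        0 < 𝔛.expectedExitTime U x) ∧
    IsNormalBauerFamily 𝓥 𝔛.exitKernel := by
  have hd := h𝔛.1
  have hopen : ∀ V ∈ 𝓥, IsOpen V := fun _ => h𝓥.isOpen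
  refine ⟨fun U hU V hV hclUV => ?_, hd.isNormalBauerFamily_exitKernel h𝓥 hD⟩
  have hUo := hopen U hU
  have hVo := hopen V hV
  have hUV : U ⊆ V := subset_closure.trans hclUV
  obtain ⟨hU1, hU2⟩ := hD U hU
  have hV1 := (hD V hV).1
  have hfin := hV1.expectedExitTime_ne_top
  exact ⟨hd.isHyperharmonic_expectedExitTime hopen hVo hV1,
    hd.isHyperharmonic_lintegral_expectedExitTime hopen hUo hVo hUV hU1 hU2 hV1, fun x hx =>
    ⟨hfin x, hd.lintegral_expectedExitTime_ne_top hUo hVo hUV (hfin x),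
      hd.expectedExitTime_sub_lintegral hUo hVo hUV (hfin x), hd.expectedExitTime_pos hUo hx⟩⟩
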